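/- Let $n,k$ be integers with $5\le k\le n-3$. For $\lambda=(\lambda_1,\dots,\lambda_n)\in\mathbb{R}^n$ let $\sigma_j(\lambda)=\sum_{1\le i_1<\cdots<i_j\le n}\lambda_{i_1}\cdots\lambda_{i_j}$ be the $j$-th elementary symmetric function, and let $\Gamma_n=\{\lambda\in\mathbb{R}^n:\sigma_j(\lambda)>0,\ j=1,\dots,n\}$, which is the positive cone $\{\lambda:\lambda_1>0,\dots,\lambda_n>0\}$. Put $$\gamma_k=\frac{n-k}{k}\ \text{ if } k\ge\lfloor n/2\rfloor+1,\qquad \gamma_k=\frac{k-2}{n-(k-2)}\ \text{ if } k\le\lfloor n/2\rfloor,$$ and $$\Sigma_{(\gamma_k)}=\Big\{\lambda\in\Gamma_n:\ \min_{1\le j\le n}\lambda_j\ \ge\ \gamma_k\max_{1\le j\le n}\lambda_j\Big\}.$$ For $f_k(\lambda)=\log\sigma_k(\lambda)$ on $\Gamma_n$ let $d^2f_k(\lambda,\xi)=\sum_{i,j=1}^n\frac{\partial^2 f_k}{\partial\lambda_i\partial\lambda_j}(\lambda)\,\xi_i\xi_j$ be its second-order differential, and for $\eta\in\mathbb{R}^n$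 let $\widetilde{d^2f_k(\lambda,\eta)}=d^2f_k\big(\lambda,(\lambda_1\eta_1,\dots,\lambda_n\eta_n)\big)$. If $\lambda\in\Sigma_{(\gamma_k)}$, then $$\widetilde{d^2f_k(\lambda,\eta)}<0\qquad\text{for all }\eta\in\mathbb{R}^n,\ \eta\ne0.$$ -/

import Mathlib

/-- The elementary symmetric function `σ_k(λ)` of `n` real variables. -/
noncomputable def sigmaFun (n k : ℕ) (lam : Fin n → ℝ) : ℝ :=
  MvPolynomial.eval lam (MvPolynomial.esymm (Fin n) ℝ k)

/-- The cone `Γ_k = {λ ∈ ℝⁿ : σ_j(λ) > 0, j = 1, …, k}`. For `k = n` it is the positive cone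
(all coordinates positive). -/
def gammaCone (n k : ℕ) : Set (Fin n → ℝ) :=
  {lam | ∀ j : ℕ, 1 ≤ j → j ≤ k → 0 < sigmaFun n j lam}

/-- The function `f_k(λ) = log σ_k(λ)`, to be considered on `Γ_n`, where `σ_k > 0`. -/
noncomputable def logSigma (n k : ℕ) (lam : Fin n → ℝ) : ℝ :=
  Real.log (sigmaFun n k lam)

/-- The second-order differential
`d² f_k(λ, ξ) = ∑_{i,j} ∂²f_k/∂λ_i∂λ_j (λ) ξ_i ξ_j` of `f_k` at `λ`. -/
noncomputable def secondDiff (n k : ℕ) (lam xi : Fin n → ℝ) : ℝ :=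
  iteratedFDeriv ℝ 2 (logSigma n k) lam ![xi, xi]

/-- The scaled second differential `d² f_k(λ, λη)`, with `λη = (λ_1 η_1, …, λ_n η_n)`. -/
noncomputable def scaledSecondDiff (n k : ℕ) (lam eta : Fin n → ℝ) : ℝ :=
  secondDiff n k lam (fun i => lam i * eta i)

/-- The constant `γ_k` for `5 ≤ k ≤ n - 3`: it is `(n - k) / k` if `⌊n/2⌋ + 1 ≤ k`, and
`(k - 2) / (n - (k - 2))` if `k ≤ ⌊n/2⌋`. -/
noncomputable def gammaConst (n k : ℕ) : ℝ :=
  if n / 2 + 1 ≤ k then ((n : ℝ) - k) / k else ((k : ℝ) - 2) / (n - (k - 2))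

/-- The set `Σ_(γ)` of all `λ ∈ Γ_n` with `λ_min ≥ γ λ_max`. -/
def sigmaSet (n : ℕ) (γ : ℝ) : Set (Fin n → ℝ) :=
  {lam | lam ∈ gammaCone n n ∧ γ * (⨆ j, lam j) ≤ ⨅ j, lam j}

open Finset Topology

/-! On the open positive orthant, write log σ_k = (log σ_k - log σ_2) + log σ_2. The bracket
telescopes into logs of quotients σ_{j+1}/σ_j, each concave by Marcus–Lopes
(`elemSymm_quotient_concave`), so its second derivative along any line is nonpositive. Strictness
comes from σ_2 alone: it is a quadratic form of Lorentzian signature, and reverse Cauchy–Schwarz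
(`lorentz_strict`) makes the Hessian of log σ_2 negative definite. The substitution ξ = λη is
invertible because every λ_i is positive. -/

/-- The elementary symmetric sum of degree `k` of the values `x i`, `i ∈ s`. -/
noncomputable def elemSymm {ι : Type*} (s : Finset ι) (k : ℕ) (x : ι → ℝ) : ℝ :=
  ∑ t ∈ powersetCard k s, ∏ i ∈ t, x i

/-! ### Recursions for elementary symmetric sums. -/

section ElemSymm

variable {ι : Type*}

theorem sigmaFun_eq_elemSymm (n k : ℕ) (x : Fin n → ℝ) :
    sigmaFun n k x = elemSymm univ k x := by
  simp [sigmaFun, elemSymm, MvPolynomial.esymm]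

theorem elemSymm_zero (s : Finset ι) (x : ι → ℝ) : elemSymm s 0 x = 1 := by
  simp [elemSymm]

theorem elemSymm_one (s : Finset ι) (x : ι → ℝ) : elemSymm s 1 x = ∑ i ∈ s, x i := by
  simp [elemSymm, powersetCard_one]

theorem elemSymm_nonneg {s : Finset ι} {x : ι → ℝ} (hx : ∀ i, 0 < x i) (k : ℕ) :
    0 ≤ elemSymm s k x :=
  sum_nonneg fun _ _ => prod_nonneg fun i _ => (hx i).le

theorem elemSymm_pos {s : Finset ι} {k : ℕ} {x : ι → ℝ} (hx : ∀ i, 0 < x i)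
    (hk : k ≤ s.card) : 0 < elemSymm s k x :=
  sum_pos (fun _ _ => prod_pos fun i _ => hx i) (powersetCard_nonempty.2 hk)

variable [DecidableEq ι]

theorem elemSymm_insert_succ {s : Finset ι} {a : ι} (ha : a ∉ s) (k : ℕ) (x : ι → ℝ) :
    elemSymm (insert a s) (k + 1) x = elemSymm s (k + 1) x + x a * elemSymm s k x := by
  have hmem : ∀ t ∈ powersetCard k s, a ∉ t := fun t ht h => ha ((mem_powersetCard.1 ht).1 h)
  unfold elemSymm
  rw [← Nat.succ_eq_add_one, powersetCard_succ_insert ha, sum_union, sum_image, mul_sum]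
  · congr 1
    exact sum_congr rfl fun t ht => prod_insert (hmem t ht)
  · intro t ht u hu h
    rw [← erase_insert (hmem t ht), ← erase_insert (hmem u hu)]
    exact congrArg (fun v => v.erase a) h
  · rw [disjoint_left]
    intro t ht h
    obtain ⟨u, -, rfl⟩ := mem_image.1 h
    exact ha ((mem_powersetCard.1 ht).1 (mem_insert_self a u))

theorem elemSymm_succ_eq_erase {s : Finset ι} {i : ι} (hi : i ∈ s) (k : ℕ) (x : ι → ℝ) :
    elemSymm s (k + 1) x
      = elemSymm (s.erase i) (k + 1) x + x i * elemSymm (s.erase i) k x := by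
  conv_lhs => rw [← insert_erase hi]
  exact elemSymm_insert_succ (notMem_erase i s) k x

/-- Euler's identity for a form of degree k + 1, the sum over `s.erase i` being the partial
derivative in x_i. -/
theorem succ_mul_elemSymm_succ (s : Finset ι) (k : ℕ) (x : ι → ℝ) :
    ((k : ℝ) + 1) * elemSymm s (k + 1) x = ∑ i ∈ s, x i * elemSymm (s.erase i) k x := by
  induction s using Finset.induction_on generalizing k with
  | empty => simp [elemSymm, powersetCard_eq_empty.2 (show (∅ : Finset ι).card < k + 1 by simp)]
  | insert a s ha ih =>
    have herase : ∀ i ∈ s, (insert a s).erase i = insert a (s.erase i) := fun i hi =>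
      erase_insert_of_ne (by rintro rfl; exact ha hi)
    rw [sum_insert ha, erase_insert ha, elemSymm_insert_succ ha]
    cases k with
    | zero =>
      simp only [elemSymm_zero, zero_add, elemSymm_one, mul_one]
      push_cast
      ring
    | succ k =>
      have hsum : ∑ i ∈ s, x i * elemSymm ((insert a s).erase i) (k + 1) x
          = ∑ i ∈ s, x i * elemSymm (s.erase i) (k + 1) x
            + x a * ∑ i ∈ s, x i * elemSymm (s.erase i) k x := by
        rw [mul_sum, ← sum_add_distrib]
        refine sum_congr rfl fun i hi => ?_
        rw [herase i hi, elemSymm_insert_succ (fun h => ha (mem_of_mem_erase h))]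
        ring
      rw [hsum, ← ih (k + 1), ← ih k]
      push_cast
      ring

theorem two_mul_elemSymm_two (s : Finset ι) (x : ι → ℝ) :
    2 * elemSymm s 2 x = (∑ i ∈ s, x i) ^ 2 - ∑ i ∈ s, x i ^ 2 := by
  have h := succ_mul_elemSymm_succ s 1 x
  have hsum : ∑ i ∈ s, x i * elemSymm (s.erase i) 1 x
      = (∑ i ∈ s, x i) ^ 2 - ∑ i ∈ s, x i ^ 2 := by
    rw [sq, sum_mul, ← sum_sub_distrib]
    refine sum_congr rfl fun i hi => ?_
    rw [elemSymm_one, ← add_sum_erase s x hi]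
    ring
  rw [hsum] at h
  norm_num at h
  linarith

end ElemSymm

/-! ### Concavity of quotients σ_{k+1}/σ_k. -/

section Quotient

variable {ι : Type*}

/-- Half the harmonic mean is monotone in the second variable. -/
theorem mul_div_add_mono {x p q : ℝ} (hx : 0 < x) (hp : 0 ≤ p) (hpq : p ≤ q) :
    x * p / (x + p) ≤ x * q / (x + q) := by
  rw [div_le_div_iff₀ (by linarith) (by linarith)]
  nlinarith [mul_le_mul_of_nonneg_left hpq (sq_nonneg x)]

/-- Half the harmonic mean is jointly concave. -/
theorem mul_div_add_concave {x y p q a b : ℝ} (hx : 0 < x) (hy : 0 < y) (hp : 0 ≤ p)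
    (hq : 0 ≤ q) (ha : 0 < a) (hb : 0 < b) :
    a * (x * p / (x + p)) + b * (y * q / (y + q))
      ≤ (a * x + b * y) * (a * p + b * q) / ((a * x + b * y) + (a * p + b * q)) := by
  have h1 : 0 < x + p := by linarith
  have h2 : 0 < y + q := by linarith
  have h3 : 0 < (a * x + b * y) + (a * p + b * q) := by positivity
  rw [← sub_nonneg]
  have key : (a * x + b * y) * (a * p + b * q) / ((a * x + b * y) + (a * p + b * q))
      - (a * (x * p / (x + p)) + b * (y * q / (y + q)))
      = a * b * (x * q - y * p) ^ 2
        / (((a * x + b * y) + (a * p + b * q)) * (x + p) * (y + q)) := by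
    field_simp
    ring
  rw [key]
  positivity

variable [DecidableEq ι]

/-- Euler's identity divided by σ_{k+1}, which is split at i in the i-th summand. Each summand
becomes half the harmonic mean of x_i and a quotient of one degree less, ready for induction. -/
theorem succ_mul_elemSymm_quotient {s : Finset ι} {k : ℕ} {x : ι → ℝ} (hx : ∀ i, 0 < x i)
    (hk : k + 1 ≤ s.card) :
    ((k : ℝ) + 2) * (elemSymm s (k + 2) x / elemSymm s (k + 1) x)
      = ∑ i ∈ s, x i * (elemSymm (s.erase i) (k + 1) x / elemSymm (s.erase i) k x)
          / (x i + elemSymm (s.erase i) (k + 1) x / elemSymm (s.erase i) k x) := by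
  have h := succ_mul_elemSymm_succ s (k + 1) x
  push_cast at h
  rw [← mul_div_assoc, show (k : ℝ) + 2 = (k : ℝ) + 1 + 1 by ring, h, sum_div]
  refine sum_congr rfl fun i hi => ?_
  have hpos : 0 < elemSymm (s.erase i) k x :=
    elemSymm_pos hx (by rw [card_erase_of_mem hi]; omega)
  have hnn : 0 ≤ elemSymm (s.erase i) (k + 1) x := elemSymm_nonneg hx _
  have hxi := hx i
  rw [elemSymm_succ_eq_erase hi k x]
  have h1 : 0 < elemSymm (s.erase i) (k + 1) x + x i * elemSymm (s.erase i) k x := by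
    positivity
  have h2 : 0 < x i + elemSymm (s.erase i) (k + 1) x / elemSymm (s.erase i) k x := by
    positivity
  rw [div_eq_div_iff h1.ne' h2.ne']
  field_simp
  ring

/-- The Marcus–Lopes inequality: quotients of consecutive elementary symmetric functions are
concave on the positive cone. -/
theorem elemSymm_quotient_concave {x y : ι → ℝ} (hx : ∀ i, 0 < x i) (hy : ∀ i, 0 < y i)
    {a b : ℝ} (ha : 0 < a) (hb : 0 < b) (k : ℕ) (s : Finset ι) (hk : k ≤ s.card) :
    a * (elemSymm s (k + 1) x / elemSymm s k x) + b * (elemSymm s (k + 1) y / elemSymm s k y)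
      ≤ elemSymm s (k + 1) (fun i => a * x i + b * y i)
          / elemSymm s k (fun i => a * x i + b * y i) := by
  have hz : ∀ i, 0 < a * x i + b * y i := fun i => by
    have := hx i
    have := hy i
    positivity
  induction k generalizing s with
  | zero =>
    simp [elemSymm_zero, elemSymm_one, mul_sum, sum_add_distrib]
  | succ k ih =>
    have hk2 : (0 : ℝ) < (k : ℝ) + 2 := by positivity
    refine le_of_mul_le_mul_left ?_ hk2
    rw [succ_mul_elemSymm_quotient hz hk, mul_add, mul_left_comm, mul_left_comm _ b,
      succ_mul_elemSymm_quotient hx hk, succ_mul_elemSymm_quotient hy hk, mul_sum, mul_sum,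
      ← sum_add_distrib]
    refine sum_le_sum fun i hi => ?_
    have hcard : k ≤ (s.erase i).card := by rw [card_erase_of_mem hi]; omega
    have hp : 0 ≤ elemSymm (s.erase i) (k + 1) x / elemSymm (s.erase i) k x :=
      div_nonneg (elemSymm_nonneg hx _) (elemSymm_nonneg hx _)
    have hq : 0 ≤ elemSymm (s.erase i) (k + 1) y / elemSymm (s.erase i) k y :=
      div_nonneg (elemSymm_nonneg hy _) (elemSymm_nonneg hy _)
    -- Joint concavity in (x_i, quotient), then monotonicity in the quotient to absorb the inductive
    -- bound.
    exact (mul_div_add_concave (hx i) (hy i) hp hq ha hb).trans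
      (mul_div_add_mono (hz i) (by positivity) (ih (s.erase i) hcard))

theorem log_elemSymm_quotient_concave {x y : ι → ℝ} (hx : ∀ i, 0 < x i) (hy : ∀ i, 0 < y i)
    {a b : ℝ} (ha : 0 < a) (hb : 0 < b) (hab : a + b = 1) {k : ℕ} {s : Finset ι}
    (hk : k + 1 ≤ s.card) :
    a * Real.log (elemSymm s (k + 1) x / elemSymm s k x)
        + b * Real.log (elemSymm s (k + 1) y / elemSymm s k y)
      ≤ Real.log (elemSymm s (k + 1) (fun i => a * x i + b * y i)
          / elemSymm s k (fun i => a * x i + b * y i)) := by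
  have hp : 0 < elemSymm s (k + 1) x / elemSymm s k x :=
    div_pos (elemSymm_pos hx hk) (elemSymm_pos hx (by omega))
  have hq : 0 < elemSymm s (k + 1) y / elemSymm s k y :=
    div_pos (elemSymm_pos hy hk) (elemSymm_pos hy (by omega))
  have hlog := strictConcaveOn_log_Ioi.concaveOn.2 hp hq ha.le hb.le hab
  simp only [smul_eq_mul] at hlog
  exact hlog.trans (Real.log_le_log (by positivity)
    (elemSymm_quotient_concave hx hy ha hb k s (by omega)))

/-- For `j ≤ k` the function `log σ_k - log σ_j` is concave on the positive cone. -/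
theorem concaveOn_log_elemSymm_sub {s : Finset ι} {j k : ℕ} (hjk : j ≤ k) (hk : k ≤ s.card) :
    ConcaveOn ℝ {x : ι → ℝ | ∀ i, 0 < x i}
      (fun x => Real.log (elemSymm s k x) - Real.log (elemSymm s j x)) := by
  have hconv : Convex ℝ {x : ι → ℝ | ∀ i, 0 < x i} := by
    rw [convex_iff_forall_pos]
    intro x hx y hy a b ha hb _ i
    have := hx i
    have := hy i
    simp only [Pi.add_apply, Pi.smul_apply, smul_eq_mul]
    positivity
  induction k, hjk using Nat.le_induction with
  | base => simpa using concaveOn_const (0 : ℝ) hconv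
  | succ k hjk ih =>
    have hstep : ConcaveOn ℝ {x : ι → ℝ | ∀ i, 0 < x i}
        (fun x => Real.log (elemSymm s (k + 1) x / elemSymm s k x)) := by
      rw [concaveOn_iff_forall_pos]
      exact ⟨hconv, fun x hx y hy a b ha hb hab =>
        log_elemSymm_quotient_concave hx hy ha hb hab hk⟩
    refine (hstep.add (ih (by omega))).congr fun x hx => ?_
    simp only [Pi.add_apply]
    rw [Real.log_div (elemSymm_pos hx hk).ne' (elemSymm_pos hx (by omega)).ne']
    ring

end Quotient

/-- Reverse Cauchy–Schwarz inequality for the quadratic form `(∑ x i) ^ 2 - ∑ x i ^ 2`, in a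
strict form with factor two. -/
theorem lorentz_strict {ι : Type*} {s : Finset ι} {x v : ι → ℝ}
    (hx : 0 < (∑ i ∈ s, x i) ^ 2 - ∑ i ∈ s, x i ^ 2) (hS : 0 < ∑ i ∈ s, x i)
    (hv : ∃ i ∈ s, v i ≠ 0) :
    ((∑ i ∈ s, x i) ^ 2 - ∑ i ∈ s, x i ^ 2) * ((∑ i ∈ s, v i) ^ 2 - ∑ i ∈ s, v i ^ 2)
      < 2 * ((∑ i ∈ s, x i) * (∑ i ∈ s, v i) - ∑ i ∈ s, x i * v i) ^ 2 := by
  set S := ∑ i ∈ s, x i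
  set X := ∑ i ∈ s, x i ^ 2
  set T := ∑ i ∈ s, v i
  set Z := ∑ i ∈ s, v i ^ 2 with hZ
  set P := ∑ i ∈ s, x i * v i
  -- With this r, v - r x has coordinate sum zero, and there the form equals -W.
  obtain ⟨r, hr⟩ : ∃ r, T = r * S := ⟨T / S, by field_simp⟩
  set W := ∑ i ∈ s, (v i - r * x i) ^ 2 with hW
  have hWnn : 0 ≤ W := sum_nonneg fun i _ => sq_nonneg _
  have hWZ : W = Z - 2 * r * P + r ^ 2 * X := by
    simp only [hW, Z, P, X, mul_sum, ← sum_sub_distrib, ← sum_add_distrib]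
    exact sum_congr rfl fun i _ => by ring
  -- All three terms are nonnegative; the extra square allowed by the factor two excludes v parallel
  -- to x, the equality case of the usual inequality.
  have key : 2 * (S * T - P) ^ 2 - (S ^ 2 - X) * (T ^ 2 - Z)
      = (S * T - P) ^ 2 + (S * T - P - r * (S ^ 2 - X)) ^ 2 + (S ^ 2 - X) * W := by
    rw [hWZ, hr]
    ring
  by_contra hcon
  have hDW : 0 ≤ (S ^ 2 - X) * W := mul_nonneg hx.le hWnn
  have h1 : (S * T - P) ^ 2 = 0 := by
    nlinarith [sq_nonneg (S * T - P), sq_nonneg (S * T - P - r * (S ^ 2 - X))]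
  have h2 : (S * T - P - r * (S ^ 2 - X)) ^ 2 = 0 := by
    nlinarith [sq_nonneg (S * T - P), sq_nonneg (S * T - P - r * (S ^ 2 - X))]
  have h3 : (S ^ 2 - X) * W = 0 := by
    nlinarith [sq_nonneg (S * T - P), sq_nonneg (S * T - P - r * (S ^ 2 - X))]
  have hb : S * T - P = 0 := by simpa using h1
  have hr0 : r = 0 := by
    rw [hb] at h2
    simpa [hx.ne'] using h2
  have hW0 : W = 0 := by simpa [hx.ne'] using h3
  obtain ⟨i, hi, hvi⟩ := hv
  have := (sum_eq_zero_iff_of_nonneg fun i _ => sq_nonneg (v i - r * x i)).1 hW0 i hi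
  simp [hr0] at this
  exact hvi this

/-! ### Second derivatives along lines. -/

section Line

theorem contDiff_elemSymm {n : ℕ} (s : Finset (Fin n)) (k : ℕ) {m : WithTop ℕ∞} :
    ContDiff ℝ m (elemSymm s k) := by
  unfold elemSymm
  exact ContDiff.sum fun t _ => contDiff_prod fun i _ => contDiff_apply ℝ ℝ i

/-- The second differential is the second derivative along a line. -/
theorem iteratedFDeriv_two_eq_deriv_deriv {E : Type*} [NormedAddCommGroup E] [NormedSpace ℝ E]
    {f : E → ℝ} {x v : E} (hf : ContDiffAt ℝ 2 f x) :
    iteratedFDeriv ℝ 2 f x ![v, v] = deriv (deriv fun t : ℝ => f (x + t • v)) 0 := by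
  have hline : ∀ t : ℝ, HasDerivAt (fun t : ℝ => x + t • v) v t := fun t => by
    simpa using ((hasDerivAt_id t).smul_const v).const_add x
  have hcont : Filter.Tendsto (fun t : ℝ => x + t • v) (𝓝 0) (𝓝 x) := by
    simpa using (hline 0).continuousAt.tendsto
  have hdiff : ∀ᶠ y in 𝓝 x, DifferentiableAt ℝ f y := by
    filter_upwards [hf.eventually (by simp)] with y hy
    exact hy.differentiableAt (by simp)
  have hfst : (deriv fun t : ℝ => f (x + t • v))
      =ᶠ[𝓝 0] fun t => fderiv ℝ f (x + t • v) v := by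
    filter_upwards [hcont.eventually hdiff] with t ht
    exact (ht.hasFDerivAt.comp_hasDerivAt t (hline t)).deriv
  have hsnd : DifferentiableAt ℝ (fderiv ℝ f) x :=
    (hf.fderiv_right (m := 1) (by norm_num)).differentiableAt (by simp)
  rw [hfst.deriv_eq, iteratedFDeriv_two_apply]
  have h0 : HasFDerivAt (fderiv ℝ f) (fderiv ℝ (fderiv ℝ f) x) (x + (0 : ℝ) • v) := by
    simpa using hsnd.hasFDerivAt
  have h1 : HasDerivAt (fun t : ℝ => fderiv ℝ f (x + t • v))
      (fderiv ℝ (fderiv ℝ f) x v) 0 := h0.comp_hasDerivAt (0 : ℝ) (hline 0)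
  have h2 : HasDerivAt (fun t : ℝ => fderiv ℝ f (x + t • v) v)
      (fderiv ℝ (fderiv ℝ f) x v v) 0 :=
    (ContinuousLinearMap.apply ℝ ℝ v).hasFDerivAt.comp_hasDerivAt (0 : ℝ) h1
  exact h2.deriv.symm

theorem deriv_deriv_nonpos_of_concaveOn {U : Set ℝ} (hU : IsOpen U) {g : ℝ → ℝ}
    (hg : ConcaveOn ℝ U g) (hd : ∀ t ∈ U, DifferentiableAt ℝ g t) {t : ℝ} (ht : t ∈ U) :
    deriv (deriv g) t ≤ 0 := by
  rw [← derivWithin_of_isOpen hU ht]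
  exact (hg.antitoneOn_deriv hd).derivWithin_nonpos

theorem deriv_deriv_log_quadratic {a b c : ℝ} (ha : 0 < a) :
    deriv (deriv fun t : ℝ => Real.log (a + b * t + c * t ^ 2)) 0
      = (2 * c * a - b ^ 2) / a ^ 2 := by
  have hq : ∀ t : ℝ, HasDerivAt (fun t : ℝ => a + b * t + c * t ^ 2) (b + c * (2 * t)) t := by
    intro t
    have h := (((hasDerivAt_id' t).const_mul b).const_add a).add
      (((hasDerivAt_id' t).fun_pow 2).const_mul c)
    refine h.congr_deriv ?_
    norm_num
  have hpos : ∀ᶠ t in 𝓝 (0 : ℝ), 0 < a + b * t + c * t ^ 2 :=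
    (hq 0).continuousAt.eventually (lt_mem_nhds (by simpa using ha))
  have hfst : (deriv fun t : ℝ => Real.log (a + b * t + c * t ^ 2))
      =ᶠ[𝓝 0] fun t => (b + c * (2 * t)) / (a + b * t + c * t ^ 2) := by
    filter_upwards [hpos] with t ht
    exact ((hq t).log ht.ne').deriv
  rw [hfst.deriv_eq]
  have hnum : HasDerivAt (fun t : ℝ => b + c * (2 * t)) (c * 2) 0 := by
    simpa using (((hasDerivAt_id (0 : ℝ)).const_mul 2).const_mul c).const_add b
  have h := (hnum.div (hq 0) (by simpa using ha.ne')).deriv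
  refine h.trans ?_
  simp
  ring

/-- On a line σ_2 is a quadratic a + bt + ct², and (log σ_2)'' has the sign of 2ac - b²; this is
where the factor two in `lorentz_strict` comes from. -/
theorem deriv_deriv_log_elemSymm_two_neg {n : ℕ} (hn : 2 ≤ n) {x v : Fin n → ℝ}
    (hx : ∀ i, 0 < x i) (hv : v ≠ 0) :
    deriv (deriv fun t : ℝ => Real.log (elemSymm univ 2 (x + t • v))) 0 < 0 := by
  have hE : 0 < elemSymm univ 2 x := elemSymm_pos hx (by simpa using hn)
  have hEx := two_mul_elemSymm_two univ x
  have hEv := two_mul_elemSymm_two univ v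
  have hlin : ∀ t : ℝ, elemSymm univ 2 (x + t • v) = elemSymm univ 2 x
      + ((∑ i, x i) * (∑ i, v i) - ∑ i, x i * v i) * t + elemSymm univ 2 v * t ^ 2 := by
    intro t
    have h := two_mul_elemSymm_two univ (x + t • v)
    have h1 : ∑ i, (x + t • v) i = ∑ i, x i + t * ∑ i, v i := by
      simp [sum_add_distrib, mul_sum]
    have h2 : ∑ i, (x + t • v) i ^ 2
        = ∑ i, x i ^ 2 + 2 * t * ∑ i, x i * v i + t ^ 2 * ∑ i, v i ^ 2 := by
      simp only [mul_sum, ← sum_add_distrib, Pi.add_apply, Pi.smul_apply, smul_eq_mul]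
      exact sum_congr rfl fun i _ => by ring
    rw [h1, h2] at h
    linear_combination h / 2 - hEx / 2 - t ^ 2 * hEv / 2
  simp only [hlin]
  rw [deriv_deriv_log_quadratic hE]
  refine div_neg_of_neg_of_pos ?_ (by positivity)
  obtain ⟨i, hi⟩ := Function.ne_iff.1 hv
  have hL := lorentz_strict (s := univ) (x := x) (v := v) (by rw [← hEx]; linarith)
    (sum_pos (fun i _ => hx i) ⟨i, mem_univ i⟩) ⟨i, mem_univ i, hi⟩
  rw [← hEx, ← hEv] at hL
  linarith

/-- For `2 ≤ k ≤ n` the function `log σ_k` has negative definite Hessian on the positive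
cone. -/
theorem secondDiff_neg {n k : ℕ} (hk : 2 ≤ k) (hkn : k ≤ n) {x v : Fin n → ℝ}
    (hx : ∀ i, 0 < x i) (hv : v ≠ 0) : secondDiff n k x v < 0 := by
  have hcard : k ≤ (univ : Finset (Fin n)).card := by simpa using hkn
  have hsmooth : ∀ j ≤ k, ∀ y : Fin n → ℝ, (∀ i, 0 < y i) →
      ContDiffAt ℝ 2 (fun y => Real.log (elemSymm univ j y)) y := fun j hj y hy =>
    (contDiff_elemSymm univ j).contDiffAt.log (elemSymm_pos hy (hj.trans hcard)).ne'
  have hfun : logSigma n k = fun y => Real.log (elemSymm univ k y) :=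
    funext fun y => by rw [logSigma, sigmaFun_eq_elemSymm]
  unfold secondDiff
  rw [hfun, iteratedFDeriv_two_eq_deriv_deriv (hsmooth k le_rfl x hx)]
  have hline : ContDiff ℝ 2 fun t : ℝ => x + t • v := by fun_prop
  -- The parameters for which the line stays in the orthant: an open convex neighbourhood of 0.
  set U : Set ℝ := {t | ∀ i, 0 < (x + t • v) i} with hUdef
  have hU : IsOpen U := by
    have : U = ⋂ i, {t : ℝ | 0 < (x + t • v) i} := by
      ext t
      simp [hUdef]
    rw [this]
    exact isOpen_iInter_of_finite fun i =>
      isOpen_lt continuous_const ((continuous_apply i).comp hline.continuous)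
  have h0 : (0 : ℝ) ∈ U := fun i => by simpa using hx i
  have hlineSmooth : ∀ j ≤ k, ∀ t ∈ U,
      ContDiffAt ℝ 2 (fun t : ℝ => Real.log (elemSymm univ j (x + t • v))) t :=
    fun j hj t ht => ContDiffAt.comp (f := fun t : ℝ => x + t • v) t (hsmooth j hj (x + t • v) ht)
      hline.contDiffAt
  set F : ℝ → ℝ := fun t => Real.log (elemSymm univ k (x + t • v))
  set L : ℝ → ℝ := fun t => Real.log (elemSymm univ 2 (x + t • v))
  have hF : ∀ t ∈ U, ContDiffAt ℝ 2 F t := hlineSmooth k le_rfl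
  have hL : ∀ t ∈ U, ContDiffAt ℝ 2 L t := hlineSmooth 2 hk
  have hconc : ConcaveOn ℝ U (F - L) := by
    have h := (concaveOn_log_elemSymm_sub hk hcard).comp_affineMap
      (AffineMap.lineMap x (x + v) : ℝ →ᵃ[ℝ] (Fin n → ℝ))
    have hmap : ∀ t : ℝ, AffineMap.lineMap x (x + v) t = x + t • v := fun t => by
      simp [AffineMap.lineMap_apply, add_comm]
    have hset : (AffineMap.lineMap x (x + v) : ℝ → Fin n → ℝ) ⁻¹' {x | ∀ i, 0 < x i} = U := by
      ext t
      simp only [Set.mem_preimage, hmap]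
      rfl
    rw [hset] at h
    refine h.congr fun t _ => ?_
    simp only [Function.comp_apply, hmap]
    rfl
  have hnonpos : deriv (deriv (F - L)) 0 ≤ 0 :=
    deriv_deriv_nonpos_of_concaveOn hU hconc
      (fun t ht => ((hF t ht).sub (hL t ht)).differentiableAt (by simp)) h0
  have hneg : deriv (deriv L) 0 < 0 := deriv_deriv_log_elemSymm_two_neg (hk.trans hkn) hx hv
  have hfst : deriv (F - L) =ᶠ[𝓝 0] deriv F - deriv L := by
    filter_upwards [hU.mem_nhds h0] with t ht
    exact deriv_sub ((hF t ht).differentiableAt (by simp)) ((hL t ht).differentiableAt (by simp))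
  have hderiv : ∀ g : ℝ → ℝ, ContDiffAt ℝ 2 g 0 → DifferentiableAt ℝ (deriv g) 0 := by
    intro g hg
    have h : DifferentiableAt ℝ (fderiv ℝ g) 0 :=
      (hg.fderiv_right (m := 1) (by norm_num)).differentiableAt (by simp)
    exact h.clm_apply (differentiableAt_const 1)
  rw [hfst.deriv_eq, deriv_sub (hderiv F (hF 0 h0)) (hderiv L (hL 0 h0))] at hnonpos
  linarith

end Line

/-- The cone `Γ_n` is contained in the open positive orthant. -/
theorem pos_of_mem_gammaCone {n : ℕ} {x : Fin n → ℝ} (hx : x ∈ gammaCone n n) (i : Fin n) :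
    0 < x i := by
  by_contra! hi
  -- The polynomial ∏ (x_j + T) has the root T = -x_i ≥ 0, yet its coefficients are the positive
  -- σ_j, with constant term σ_n.
  have hprod : ∏ j, (x j + -x i) = 0 := prod_eq_zero (mem_univ i) (by ring)
  rw [prod_add, sum_powerset] at hprod
  have hterm : ∀ j ∈ range ((univ : Finset (Fin n)).card + 1),
      ∑ t ∈ powersetCard j univ, (∏ l ∈ t, x l) * ∏ l ∈ univ \ t, -x i
        = sigmaFun n j x * (-x i) ^ (n - j) := by
    intro j _
    rw [sigmaFun_eq_elemSymm, elemSymm, sum_mul]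
    refine sum_congr rfl fun t ht => ?_
    rw [prod_const, card_sdiff_of_subset (subset_univ t), (mem_powersetCard.1 ht).2]
    simp
  rw [sum_congr rfl hterm, card_univ, Fintype.card_fin, sum_range_succ] at hprod
  have hn : 1 ≤ n := i.pos
  have hlast := hx n hn le_rfl
  have hrest : 0 ≤ ∑ j ∈ range n, sigmaFun n j x * (-x i) ^ (n - j) := by
    refine sum_nonneg fun j hj => mul_nonneg ?_ (pow_nonneg (by linarith) _)
    rcases Nat.eq_zero_or_pos j with rfl | hj0
    · rw [sigmaFun_eq_elemSymm, elemSymm_zero]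
      exact zero_le_one
    · exact (hx j hj0 (mem_range.1 hj).le).le
  simp only [Nat.sub_self, pow_zero, mul_one] at hprod
  linarith

theorem proposition4p8 (n k : ℕ) (hk : 5 ≤ k) (hkn : k + 3 ≤ n)
    (lam : Fin n → ℝ) (hlam : lam ∈ sigmaSet n (gammaConst n k))
    (eta : Fin n → ℝ) (heta : eta ≠ 0) :
    scaledSecondDiff n k lam eta < 0 := by
  have hpos : ∀ i, 0 < lam i := pos_of_mem_gammaCone hlam.1
  refine secondDiff_neg (by omega) (by omega) hpos fun h => heta (funext fun i => ?_)
  have hi : lam i * eta i = 0 := congrFun h i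
  exact (mul_eq_zero.1 hi).resolve_left (hpos i).ne'
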